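/- Let $G$ be a finite simple connected graph of Euler genus $g$, i.e. $g$ is the minimum integer $k\ge 0$ such that $G$ embeds in the orientable surface with $k/2$ handles ($k$ even) or in the non-orientable surface with $k\geq 1$ cross-caps. Equivalently, $g$ is the minimum of $2-|V(G)|+|E(G)|-|F|$ over all embedding schemes of $G$ (a rotation system together with an edge signature), where $F$ is the set of faces of the scheme. A finite graph is planar if each of its connected components has Euler genus $0$. Let $(V_0,V_1,\dots,V_t)$ be a BFS layering of $G$, i.e. for some vertex $r$ of $G$ we have $V_i=\{v\in V(G):\mathrm{dist}_G(r,v)=i\}$ for $0\le i\le t$, where $t=\max_{v}\mathrm{dist}_G(r,v)$. Then there is a set $Z\subseteq V(G)$ with $|Z\cap V_i|\le 2g$ for every $i\in\{0,1,\dots,t\}$ such that $G-Z$ is planar. -/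

import Mathlib

namespace SimpleGraph

variable {V : Type*} {G : SimpleGraph V}

/-- An embedding scheme of a finite graph: a combinatorial description of a cellular embedding of
each connected component of the graph in a closed surface, orientable or not. It consists of a
rotation system (for each vertex a cyclic order of the darts leaving it) together with a signature
that says which edges are twisted, i.e. reverse the local orientation. -/
structure EmbeddingScheme (G : SimpleGraph V) where
  /-- `rot d` is the dart that follows `d` in the rotation at the vertex `d.fst`. -/
  rot : Equiv.Perm G.Dart
  rot_fst : ∀ d, (rot d).fst = d.fst
  /-- the darts leaving a vertex form a single cycle of `rot` -/
  rot_cyclic : ∀ d d' : G.Dart, d.fst = d'.fst → rot.SameCycle d d'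
  /-- `twist e = true` if and only if the edge `e` has signature `-1`. -/
  twist : G.edgeSet → Bool

namespace EmbeddingScheme

/-- The pair `(d, true)` stands for the side of the edge of `d` that faces `rot d` when seen from
the vertex `d.fst`, and `(d, false)` for the side that faces `rot⁻¹ d`. This relation says that two
such sides follow each other on the boundary of a face: either they are the same side of
an edge, seen from its two ends, or they meet in the corner between consecutive darts. -/
inductive FaceRel (S : EmbeddingScheme G) : G.Dart × Bool → G.Dart × Bool → Prop
  | edge (d : G.Dart) (s : Bool) :
      FaceRel S (d, s) (d.symm, Bool.xor (!s) (S.twist ⟨d.edge, d.edge_mem⟩))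
  | corner (d : G.Dart) : FaceRel S (d, true) (S.rot d, false)

/-- The faces with at least one edge on their boundary: the classes of the equivalence relation
generated by `FaceRel`. -/
def Face (S : EmbeddingScheme G) : Type _ := Quot S.FaceRel

/-- The number of faces. A component that is an isolated vertex is embedded in the sphere
with exactly one face, which has no edge on its boundary. -/
noncomputable def faceCount (S : EmbeddingScheme G) : ℕ :=
  Nat.card S.Face + Nat.card {v : V // ∀ w, ¬ G.Adj v w}

/-- The Euler genus of an embedding scheme, by Euler's formula `2 - (|V| - |E| + |F|)` when `G` is
connected, and summed over the components of `G` in general. -/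
noncomputable def eulerGenus (S : EmbeddingScheme G) : ℤ :=
  2 * (Nat.card G.ConnectedComponent : ℤ)
    - ((Nat.card V : ℤ) - (Nat.card G.edgeSet : ℤ) + (S.faceCount : ℤ))

end EmbeddingScheme

/-- `g` is the Euler genus of the finite graph `G`: the least Euler genus of an embedding of `G`,
over all orientable and non-orientable embeddings. -/
def HasEulerGenus (G : SimpleGraph V) (g : ℕ) : Prop :=
  IsLeast {k : ℕ | ∃ S : EmbeddingScheme G, S.eulerGenus = (k : ℤ)} g

/-- A finite graph is planar if it has an embedding of Euler genus `0`, that is, one in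
which every component is embedded in the sphere. -/
def IsPlanar (G : SimpleGraph V) : Prop :=
  ∃ S : EmbeddingScheme G, S.eulerGenus = 0

/-- `L 0, …, L t` is a BFS layering of `G`: for some root `r`, the layer `L i` is the set of
vertices at distance `i` from `r`, and `t` is the largest distance of a vertex from `r`. -/
def IsBFSLayering (G : SimpleGraph V) {t : ℕ} (L : Fin (t + 1) → Set V) : Prop :=
  ∃ r : V, IsGreatest (Set.range (G.dist r)) t ∧ ∀ i, L i = {v | G.dist r v = (i : ℕ)}

end SimpleGraph

/-! Fix an embedding scheme of Euler genus `g` and a BFS tree `T`. Each edge set `A` spans a ribbon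
subgraph (discs at the vertices, bands along `A`) with Euler genus `2c(A) - |V| + |A| - b(A)`, where
`c` counts components and `b` boundary components. This number is nonnegative and monotone in `A`
(`ribbonGenus_mono`).

Take `A ⊇ T` minimal with the genus of the whole scheme. Minimality puts both sides of every edge of
`A \ T` on one boundary component, so `b(A) ≤ b(T) ≤ 1`, and Euler's formula gives `|A \ T| ≤ g`
(`exists_ribbonGenus_univ_le`). Let `Z` consist of the ends of the edges of `A \ T` and all their
ancestors in `T`: at most `2g` ends, each with at most one ancestor in a given layer.

The part `W` of `A` inside `Z` still has full genus, since only pendant tree edges were dropped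
(`ribbonGenus_le_of_closed`). The edges avoiding `Z` share no vertex with `W`, so their genus and
that of `W` add up to at most the total (`ribbonGenus_add_le`), which leaves genus `0` for them. The
scheme induced on `G - Z` has no larger genus (`exists_eulerGenus_induce_le`). -/

/-! ### Counting classes of quotients, and parity -/

theorem Nat.card_quot_le_of_rel {α : Type*} [Finite α] {r s : α → α → Prop}
    (h : ∀ a b, r a b → Quot.mk s a = Quot.mk s b) : Nat.card (Quot s) ≤ Nat.card (Quot r) := by
  refine Nat.card_le_card_of_surjective (Quot.lift (Quot.mk s) h) ?_
  rintro ⟨a⟩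
  exact ⟨Quot.mk r a, rfl⟩

/-- The relation `r` with the additional pair `(x, y)`. -/
def AddPair {α : Type*} (r : α → α → Prop) (x y a b : α) : Prop := r a b ∨ (a = x ∧ b = y)

theorem AddPair.mk_eq_mk {α : Type*} {r : α → α → Prop} (x y : α) {a b : α}
    (h : Quot.mk r a = Quot.mk r b) : Quot.mk (AddPair r x y) a = Quot.mk (AddPair r x y) b :=
  congrArg (Quot.lift (Quot.mk (AddPair r x y)) fun _ _ h => Quot.sound (Or.inl h)) h

theorem AddPair.mk_eq_mk_pair {α : Type*} (r : α → α → Prop) (x y : α) :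
    Quot.mk (AddPair r x y) x = Quot.mk (AddPair r x y) y :=
  Quot.sound (Or.inr ⟨rfl, rfl⟩)

theorem Nat.card_quot_eq_addPair_add_one {α : Type*} [Finite α] {r : α → α → Prop} {x y : α}
    (h : Quot.mk r x ≠ Quot.mk r y) :
    Nat.card (Quot r) = Nat.card (Quot (AddPair r x y)) + 1 := by
  classical
  let g : Quot r → {q : Quot r // q ≠ Quot.mk r y} := fun q =>
    if hq : q = Quot.mk r y then ⟨Quot.mk r x, h⟩ else ⟨q, hq⟩
  let e : {q : Quot r // q ≠ Quot.mk r y} ≃ Quot (AddPair r x y) :=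
    { toFun := fun q => Quot.lift (Quot.mk (AddPair r x y))
        (fun _ _ h => Quot.sound (Or.inl h)) q.1
      invFun := Quot.lift (fun a => g (Quot.mk r a)) (by
        rintro a b (hab | ⟨rfl, rfl⟩)
        · exact congrArg g (Quot.sound hab)
        · simp [g, h])
      left_inv := by
        rintro ⟨⟨a⟩, ha⟩
        exact dif_neg ha
      right_inv := by
        rintro ⟨a⟩
        change Quot.lift (Quot.mk (AddPair r x y)) _ (g (Quot.mk r a)).1 = Quot.mk _ a
        by_cases ha : Quot.mk r a = Quot.mk r y
        · simp only [g, ha, dite_true]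
          exact (AddPair.mk_eq_mk_pair r x y).trans (AddPair.mk_eq_mk x y ha.symm)
        · simp only [g, ha, dite_false] }
  rw [← Nat.card_congr e, ← Finite.card_option]
  exact Nat.card_congr (Equiv.optionSubtypeNe (Quot.mk r y)).symm

theorem Nat.card_quot_le_addPair_add_one {α : Type*} [Finite α] (r : α → α → Prop) (x y : α) :
    Nat.card (Quot r) ≤ Nat.card (Quot (AddPair r x y)) + 1 := by
  by_cases h : Quot.mk r x = Quot.mk r y
  · refine (Nat.card_quot_le_of_rel ?_).trans (Nat.le_succ _)
    rintro a b (hab | ⟨rfl, rfl⟩)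
    exacts [Quot.sound hab, h]
  · exact (Nat.card_quot_eq_addPair_add_one h).le

theorem Set.even_ncard_of_involution {α : Type*} [Finite α] (C : Set α) (f : α → α)
    (hf : ∀ a ∈ C, f (f a) = a) (hne : ∀ a ∈ C, f a ≠ a) (hC : ∀ a ∈ C, f a ∈ C) :
    Even C.ncard := by
  classical
  have := Fintype.ofFinite α
  have h := Finset.sum_involution (s := C.toFinset) (f := fun _ => (1 : ZMod 2))
    (fun a _ => f a) (fun _ _ => by decide) (fun a ha _ => hne a (by simpa using ha))
    (fun a ha => by simpa using hC a (by simpa using ha))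
    (fun a ha => hf a (by simpa using ha))
  rw [Set.ncard_eq_toFinset_card']
  simpa [ZMod.natCast_eq_zero_iff_even] using h

/-! ### Ribbon subgraphs and how one edge changes their boundary -/

namespace SimpleGraph

variable {V : Type*} {G : SimpleGraph V}

instance [Finite V] : Finite G.Dart :=
  Finite.of_injective _ (Dart.toProd_injective (G := G))

/-- The edge of a dart, as an element of the edge set. -/
def Dart.toEdge (d : G.Dart) : G.edgeSet := ⟨d.edge, d.edge_mem⟩

@[simp]
theorem Dart.toEdge_symm (d : G.Dart) : d.symm.toEdge = d.toEdge :=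
  Subtype.ext d.edge_symm

theorem Dart.toEdge_surjective : Function.Surjective (Dart.toEdge (G := G)) := by
  rintro ⟨e, he⟩
  induction e with
  | h v w => exact ⟨⟨(v, w), he⟩, rfl⟩

theorem Dart.toEdge_eq_iff {d d' : G.Dart} : d.toEdge = d'.toEdge ↔ d = d' ∨ d = d'.symm :=
  Subtype.ext_iff.trans (dart_edge_eq_iff d d')

/-- Two vertices are the ends of an edge in `A`. -/
def JoinRel (A : Set G.edgeSet) (v w : V) : Prop :=
  ∃ d : G.Dart, d.toEdge ∈ A ∧ d.fst = v ∧ d.snd = w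

/-- The number of components of the spanning subgraph with edge set `A`. -/
noncomputable def componentCount (A : Set G.edgeSet) : ℕ := Nat.card (Quot (JoinRel A))

namespace EmbeddingScheme

variable (S : EmbeddingScheme G)

/-- The side of an edge that meets a given one in a corner. -/
def cornerMove : G.Dart × Bool → G.Dart × Bool
  | (d, true) => (S.rot d, false)
  | (d, false) => (S.rot.symm d, true)

open Classical in
/-- The side that follows a given one on the boundary of the ribbon subgraph with edge set `A`:
edges in `A` are followed to their other end, and edges outside `A` are skipped. -/
noncomputable def edgeMove (A : Set G.edgeSet) (f : G.Dart × Bool) : G.Dart × Bool :=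
  if f.1.toEdge ∈ A then (f.1.symm, Bool.xor (!f.2) (S.twist f.1.toEdge)) else (f.1, !f.2)

/-- Two sides of edges follow each other on the boundary of the ribbon subgraph with
edge set `A`. -/
def BoundaryRel (A : Set G.edgeSet) (f f' : G.Dart × Bool) : Prop :=
  f' = S.cornerMove f ∨ f' = S.edgeMove A f

/-- The number of boundary components of the ribbon subgraph with edge set `A`. -/
noncomputable def boundaryCount (A : Set G.edgeSet) : ℕ :=
  Nat.card (Quot (S.BoundaryRel A)) + Nat.card {v : V // ∀ w, ¬ G.Adj v w}

/-- The Euler genus of the ribbon subgraph with edge set `A`. -/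
noncomputable def ribbonGenus (A : Set G.edgeSet) : ℤ :=
  2 * (componentCount A : ℤ) - Nat.card V + A.ncard - S.boundaryCount A

variable {S} {A : Set G.edgeSet}

theorem cornerMove_cornerMove (f : G.Dart × Bool) : S.cornerMove (S.cornerMove f) = f := by
  rcases f with ⟨d, _ | _⟩ <;> simp [cornerMove]

theorem cornerMove_ne (f : G.Dart × Bool) : S.cornerMove f ≠ f := by
  rcases f with ⟨d, _ | _⟩ <;> simp [cornerMove]

theorem edgeMove_of_mem {f : G.Dart × Bool} (h : f.1.toEdge ∈ A) :
    S.edgeMove A f = (f.1.symm, Bool.xor (!f.2) (S.twist f.1.toEdge)) := if_pos h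

theorem edgeMove_of_notMem {f : G.Dart × Bool} (h : f.1.toEdge ∉ A) :
    S.edgeMove A f = (f.1, !f.2) := if_neg h

theorem toEdge_edgeMove (f : G.Dart × Bool) : (S.edgeMove A f).1.toEdge = f.1.toEdge := by
  by_cases h : f.1.toEdge ∈ A
  · simp [edgeMove_of_mem h]
  · simp [edgeMove_of_notMem h]

theorem edgeMove_edgeMove (f : G.Dart × Bool) : S.edgeMove A (S.edgeMove A f) = f := by
  by_cases h : f.1.toEdge ∈ A
  · rw [edgeMove_of_mem (f := S.edgeMove A f) (by rwa [toEdge_edgeMove]), edgeMove_of_mem h]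
    simp
  · rw [edgeMove_of_notMem (f := S.edgeMove A f) (by rwa [toEdge_edgeMove]),
      edgeMove_of_notMem h]
    simp

theorem edgeMove_ne (f : G.Dart × Bool) : S.edgeMove A f ≠ f := by
  by_cases h : f.1.toEdge ∈ A
  · rw [edgeMove_of_mem h]
    exact fun h' => f.1.symm_ne (congrArg Prod.fst h')
  · rw [edgeMove_of_notMem h]
    exact fun h' => by simpa using congrArg Prod.snd h'

theorem edgeMove_congr {A' : Set G.edgeSet} {f : G.Dart × Bool}
    (h : f.1.toEdge ∈ A ↔ f.1.toEdge ∈ A') : S.edgeMove A f = S.edgeMove A' f := by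
  by_cases h' : f.1.toEdge ∈ A
  · rw [edgeMove_of_mem h', edgeMove_of_mem (h.1 h')]
  · rw [edgeMove_of_notMem h', edgeMove_of_notMem (fun h'' => h' (h.2 h''))]

theorem mk_corner (f : G.Dart × Bool) :
    Quot.mk (S.BoundaryRel A) (S.cornerMove f) = Quot.mk _ f :=
  (Quot.sound (r := S.BoundaryRel A) (Or.inl rfl)).symm

theorem mk_edgeMove (f : G.Dart × Bool) :
    Quot.mk (S.BoundaryRel A) (S.edgeMove A f) = Quot.mk _ f :=
  (Quot.sound (r := S.BoundaryRel A) (Or.inr rfl)).symm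

theorem mk_not {d : G.Dart} (h : d.toEdge ∉ A) (s : Bool) :
    Quot.mk (S.BoundaryRel A) (d, !s) = Quot.mk _ (d, s) := by
  have := mk_edgeMove (S := S) (A := A) (d, s)
  rwa [edgeMove_of_notMem h] at this

theorem mk_eq_of_notMem {d : G.Dart} (h : d.toEdge ∉ A) (s s' : Bool) :
    Quot.mk (S.BoundaryRel A) (d, s) = Quot.mk _ (d, s') := by
  rcases s <;> rcases s' <;> first | rfl | exact mk_not h true | exact mk_not h false

theorem mk_symm {d : G.Dart} (h : d.toEdge ∈ A) (s : Bool) :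
    Quot.mk (S.BoundaryRel A) (d.symm, Bool.xor (!s) (S.twist d.toEdge)) = Quot.mk _ (d, s) := by
  have := mk_edgeMove (S := S) (A := A) (d, s)
  rwa [edgeMove_of_mem h] at this

/-- A boundary component that is cut open along `e` contains a second side of `e`. -/
theorem exists_ne_mk_eq_mk [Finite V] (A : Set G.edgeSet) (f₀ : G.Dart × Bool) :
    ∃ f : G.Dart × Bool, f ≠ f₀ ∧ f.1.toEdge = f₀.1.toEdge ∧
      ∀ A' : Set G.edgeSet, A' \ {f₀.1.toEdge} = A \ {f₀.1.toEdge} →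
        Quot.mk (S.BoundaryRel A') f = Quot.mk _ f₀ := by
  let R : G.Dart × Bool → G.Dart × Bool → Prop := fun f f' =>
    f' = S.cornerMove f ∨ (f.1.toEdge ≠ f₀.1.toEdge ∧ f' = S.edgeMove A f)
  let C : Set (G.Dart × Bool) := {f | Quot.mk R f = Quot.mk R f₀}
  let E : Set (G.Dart × Bool) := {f | f.1.toEdge = f₀.1.toEdge}
  -- `C` is what is reached from `f₀` without crossing its edge. Corner moves pair off `C`, and edge
  -- moves pair off the part of `C` away from that edge. Hence `C` meets the edge in an even number
  -- of sides, so in a second one.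
  have h1 : Even C.ncard := Set.even_ncard_of_involution C S.cornerMove
    (fun f _ => cornerMove_cornerMove f) (fun f _ => cornerMove_ne f)
    (fun f hf => (Quot.sound (r := R) (Or.inl rfl)).symm.trans hf)
  have h2 : Even (C \ E).ncard := Set.even_ncard_of_involution (C \ E) (S.edgeMove A)
    (fun f _ => edgeMove_edgeMove f) (fun f _ => edgeMove_ne f)
    (fun f hf => ⟨(Quot.sound (r := R) (Or.inr ⟨hf.2, rfl⟩)).symm.trans hf.1, by
      simpa [E, toEdge_edgeMove] using hf.2⟩)
  have h3 : (C ∩ E).ncard + (C \ E).ncard = C.ncard := Set.ncard_inter_add_ncard_sdiff_eq_ncard C E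
  have h4 : f₀ ∈ C ∩ E := ⟨rfl, rfl⟩
  have h5 : 1 < (C ∩ E).ncard := by
    have := (Set.ncard_pos (s := C ∩ E)).2 ⟨f₀, h4⟩
    grind
  obtain ⟨f, hf, hne⟩ := Set.exists_ne_of_one_lt_ncard h5 f₀
  refine ⟨f, hne, hf.2, fun A' hA' => ?_⟩
  refine congrArg (Quot.lift (r := R) (Quot.mk (S.BoundaryRel A')) ?_) hf.1
  rintro a b (rfl | ⟨ha, rfl⟩)
  · exact (mk_corner a).symm
  · rw [← mk_edgeMove a]
    congr 1
    apply edgeMove_congr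
    have := Set.ext_iff.1 hA' a.1.toEdge
    simpa [ha] using this

variable {d : G.Dart}

theorem mk_eq_mk_of_rel_insert {β : Type*} {q : G.Dart × Bool → β}
    (hq : ∀ f f', S.BoundaryRel A f f' → q f = q f')
    (hd : ∀ s, q (d.symm, s) = q (d, !s)) (hd' : q (d, true) = q (d, false))
    {f f' : G.Dart × Bool} (h : S.BoundaryRel (insert d.toEdge A) f f') : q f = q f' := by
  have key : ∀ f : G.Dart × Bool, f.1.toEdge = d.toEdge → q f = q (d, true) := by
    rintro ⟨d', s⟩ h
    rcases Dart.toEdge_eq_iff.1 h with rfl | rfl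
    · rcases s <;> simp [hd']
    · rcases s <;> simp [hd, hd']
  rcases h with rfl | rfl
  · exact hq _ _ (Or.inl rfl)
  · by_cases h : f.1.toEdge = d.toEdge
    · rw [key f h, key _ ((toEdge_edgeMove f).trans h)]
    · refine hq _ _ (Or.inr (edgeMove_congr ?_))
      simp [h]

/-- The two relations differ only on the four sides of the edge. Here the edge moves already tie the
sides at `d.symm` to those at `d`, so one further identification suffices. -/
theorem mk_eq_mk_of_rel_of_insert {β : Type*} {q : G.Dart × Bool → β}
    (hq : ∀ f f', S.BoundaryRel (insert d.toEdge A) f f' → q f = q f')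
    (hd : q (d, true) = q (d, false)) {f f' : G.Dart × Bool} (h : S.BoundaryRel A f f') :
    q f = q f' := by
  have key : ∀ f : G.Dart × Bool, f.1.toEdge = d.toEdge → q f = q (d, true) := by
    have h5 : ∀ s, q (d, s) = q (d, true) := by
      rintro (_ | _)
      exacts [hd.symm, rfl]
    rintro ⟨d', s⟩ h
    rcases Dart.toEdge_eq_iff.1 h with h | h
    · simp only at h
      rw [h, h5]
    · simp only at h
      have h6 := hq (d', s) _ (Or.inr rfl)
      rwa [edgeMove_of_mem (by simp [h]), h, Dart.symm_symm, h5, ← h] at h6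
  rcases h with rfl | rfl
  · exact hq _ _ (Or.inl rfl)
  · by_cases h : f.1.toEdge = d.toEdge
    · rw [key f h, key _ ((toEdge_edgeMove f).trans h)]
    · refine hq _ _ (Or.inr (edgeMove_congr ?_))
      simp [h]

variable [Finite V]

/-- Outside `A` the two sides at each end of the edge agree, so gluing its two ends identifies all
four sides. -/
theorem boundaryCount_le_insert (hd : d.toEdge ∉ A) :
    S.boundaryCount A ≤ S.boundaryCount (insert d.toEdge A) + 1 := by
  have h1 := Nat.card_quot_le_addPair_add_one (S.BoundaryRel A) (d, true) (d.symm, true)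
  have h2 : Nat.card (Quot (AddPair (S.BoundaryRel A) (d, true) (d.symm, true))) ≤
      Nat.card (Quot (S.BoundaryRel (insert d.toEdge A))) := by
    apply Nat.card_quot_le_of_rel
    intro f f' h
    have key := fun {a b} h => AddPair.mk_eq_mk (r := S.BoundaryRel A) (d, true) (d.symm, true)
      (a := a) (b := b) h
    refine mk_eq_mk_of_rel_insert (fun f f' h => key (Quot.sound h)) (fun s => ?_) ?_ h
    · rw [key (mk_eq_of_notMem (d := d.symm) (by simpa) s true),
        key (mk_eq_of_notMem hd (!s) true)]
      exact (AddPair.mk_eq_mk_pair _ _ _).symm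
    · exact key (mk_eq_of_notMem hd _ _)
  unfold boundaryCount
  omega

theorem boundaryCount_insert_le (A : Set G.edgeSet) (d : G.Dart) :
    S.boundaryCount (insert d.toEdge A) ≤ S.boundaryCount A + 1 := by
  have h1 := Nat.card_quot_le_addPair_add_one (S.BoundaryRel (insert d.toEdge A))
    (d, true) (d, false)
  have h2 : Nat.card (Quot (AddPair (S.BoundaryRel (insert d.toEdge A)) (d, true) (d, false))) ≤
      Nat.card (Quot (S.BoundaryRel A)) :=
    Nat.card_quot_le_of_rel fun f f' h => mk_eq_mk_of_rel_of_insert (q := Quot.mk (AddPair _ _ _))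
      (fun f f' h => Quot.sound (r := AddPair _ _ _) (Or.inl h)) (AddPair.mk_eq_mk_pair _ _ _) h
  unfold boundaryCount
  omega

/-- The parity partner of `(d, true)` cannot lie at the other end of the edge, so it is `(d,
false)`. The path joining them avoids the edge and survives the insertion, which therefore merges
two boundary components. -/
theorem boundaryCount_insert_lt (hd : d.toEdge ∉ A)
    (hne : Quot.mk (S.BoundaryRel A) (d, true) ≠ Quot.mk _ (d.symm, true)) :
    S.boundaryCount (insert d.toEdge A) + 1 ≤ S.boundaryCount A := by
  have h1 := Nat.card_quot_eq_addPair_add_one hne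
  obtain ⟨f, hf, hfe, hA⟩ := exists_ne_mk_eq_mk (S := S) A (d, true)
  obtain rfl : f = (d, false) := by
    rcases f with ⟨d', s⟩
    rcases Dart.toEdge_eq_iff.1 hfe with h | h
    · subst h; rcases s <;> simp_all
    · simp only at h
      subst h
      exact absurd ((hA A rfl).symm.trans (mk_eq_of_notMem (by simpa) s true)) hne
  have h3 := hA (insert d.toEdge A) (by simp)
  have h2 : Nat.card (Quot (S.BoundaryRel (insert d.toEdge A))) ≤
      Nat.card (Quot (AddPair (S.BoundaryRel A) (d, true) (d.symm, true))) := by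
    apply Nat.card_quot_le_of_rel
    rintro f f' (h | ⟨rfl, rfl⟩)
    · exact mk_eq_mk_of_rel_of_insert (fun _ _ h => Quot.sound h) h3.symm h
    · rw [← mk_edgeMove (d.symm, true), edgeMove_of_mem (by simp), Dart.symm_symm]
      generalize (Bool.xor _ _) = s
      rcases s
      exacts [h3.symm, rfl]
  unfold boundaryCount
  omega

/-- The parity partner of `(d, true)` is not `(d, false)`, so it lies at the other end. The joining
path avoids the edge, so both ends agree for `A`, and deleting the edge merges its two sides. -/
theorem boundaryCount_lt_insert (hd : d.toEdge ∉ A)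
    (hne : Quot.mk (S.BoundaryRel (insert d.toEdge A)) (d, true) ≠ Quot.mk _ (d, false)) :
    S.boundaryCount A + 1 ≤ S.boundaryCount (insert d.toEdge A) := by
  have h1 := Nat.card_quot_eq_addPair_add_one hne
  obtain ⟨f, hf, hfe, hA⟩ := exists_ne_mk_eq_mk (S := S) A (d, true)
  have h3 : Quot.mk (S.BoundaryRel A) (d.symm, true) = Quot.mk _ (d, true) := by
    rcases f with ⟨d', s⟩
    rcases Dart.toEdge_eq_iff.1 hfe with h | h
    · simp only at h
      subst h
      rcases s
      · exact absurd (hA (insert d'.toEdge A) (by simp)).symm hne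
      · exact absurd rfl hf
    · simp only at h
      subst h
      exact (mk_eq_of_notMem (by simpa) _ _).trans (hA A rfl)
  have h2 : Nat.card (Quot (S.BoundaryRel A)) ≤
      Nat.card (Quot (AddPair (S.BoundaryRel (insert d.toEdge A)) (d, true) (d, false))) := by
    apply Nat.card_quot_le_of_rel
    rintro f f' (h | ⟨rfl, rfl⟩)
    · refine mk_eq_mk_of_rel_insert (fun _ _ h => Quot.sound h) (fun s => ?_)
        (mk_eq_of_notMem hd _ _) h
      rw [mk_eq_of_notMem (d := d.symm) (by simpa) s true, h3]
      exact mk_eq_of_notMem hd _ _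
    · exact mk_eq_of_notMem hd _ _
  unfold boundaryCount
  omega

end EmbeddingScheme
end SimpleGraph

/-! ### Components, and monotonicity and superadditivity of the ribbon genus -/

namespace SimpleGraph

variable {V : Type*} {G : SimpleGraph V} {A : Set G.edgeSet}

theorem componentCount_le_insert [Finite V] (A : Set G.edgeSet) (d : G.Dart) :
    componentCount A ≤ componentCount (insert d.toEdge A) + 1 := by
  refine (Nat.card_quot_le_addPair_add_one (JoinRel A) d.fst d.snd).trans
    (Nat.succ_le_succ (Nat.card_quot_le_of_rel ?_))
  rintro v w ⟨d', h | h, rfl, rfl⟩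
  · have key := AddPair.mk_eq_mk_pair (JoinRel A) d.fst d.snd
    rcases Dart.toEdge_eq_iff.1 h with rfl | rfl
    exacts [key, key.symm]
  · exact Quot.sound (Or.inl ⟨d', h, rfl, rfl⟩)

theorem componentCount_le_insert_of_mk_eq [Finite V] {d : G.Dart}
    (hd : Quot.mk (JoinRel A) d.fst = Quot.mk _ d.snd) :
    componentCount A ≤ componentCount (insert d.toEdge A) := by
  refine Nat.card_quot_le_of_rel ?_
  rintro v w ⟨d', h | h, rfl, rfl⟩
  · rcases Dart.toEdge_eq_iff.1 h with rfl | rfl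
    exacts [hd, hd.symm]
  · exact Quot.sound ⟨d', h, rfl, rfl⟩

theorem componentCount_univ [Finite V] :
    componentCount (Set.univ : Set G.edgeSet) = Nat.card G.ConnectedComponent := by
  refine le_antisymm (Nat.card_quot_le_of_rel ?_) (Nat.card_quot_le_of_rel ?_)
  · rintro v w ⟨p⟩
    induction p with
    | nil => rfl
    | cons h p ih => exact (Quot.sound ⟨⟨(_, _), h⟩, trivial, rfl, rfl⟩).trans ih
  · rintro v w ⟨d, -, rfl, rfl⟩
    exact Quot.sound d.adj.reachable

theorem card_le_componentCount_empty [Finite V] :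
    Nat.card V ≤ componentCount (∅ : Set G.edgeSet) :=
  Nat.card_le_card_of_surjective (Quot.lift id fun _ _ ⟨_, h, _⟩ => h.elim)
    fun v => ⟨Quot.mk _ v, rfl⟩

/-- Edge sets on the two sides of a vertex partition have independent components. -/
theorem componentCount_add_le [Finite V] {Z : Set V} {B W : Set G.edgeSet}
    (hB : ∀ d : G.Dart, d.toEdge ∈ B → d.fst ∉ Z) (hW : ∀ d : G.Dart, d.toEdge ∈ W → d.fst ∈ Z) :
    componentCount B + componentCount W ≤ componentCount (B ∪ W) + Nat.card V := by
  classical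
  unfold componentCount
  rw [← Nat.card_sum, ← Nat.card_sum]
  -- The summand `V` supplies the singleton components: each vertex is isolated in whichever of `B`,
  -- `W` lives on the other side of the partition.
  refine Nat.card_le_card_of_surjective (Sum.elim
    (Quot.lift (fun v => if v ∈ Z then Sum.inr (Quot.mk (JoinRel W) v)
      else Sum.inl (Quot.mk (JoinRel B) v)) ?_)
    (fun v => if v ∈ Z then Sum.inl (Quot.mk (JoinRel B) v)
      else Sum.inr (Quot.mk (JoinRel W) v))) ?_
  · rintro v w ⟨d, h | h, rfl, rfl⟩
    · have h1 := hB d h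
      have h2 : d.snd ∉ Z := hB d.symm (by simpa using h)
      simp only [h1, h2, if_false]
      exact congrArg _ (Quot.sound ⟨d, h, rfl, rfl⟩)
    · have h1 := hW d h
      have h2 : d.snd ∈ Z := hW d.symm (by simpa using h)
      simp only [h1, h2, if_true]
      exact congrArg _ (Quot.sound ⟨d, h, rfl, rfl⟩)
  · rintro (q | q) <;> obtain ⟨v⟩ := q <;> by_cases hv : v ∈ Z
    · exact ⟨Sum.inr v, if_pos hv⟩
    · exact ⟨Sum.inl (Quot.mk _ v), if_neg hv⟩
    · exact ⟨Sum.inl (Quot.mk _ v), if_pos hv⟩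
    · exact ⟨Sum.inr v, if_neg hv⟩

namespace EmbeddingScheme

variable {S : EmbeddingScheme G}

/-- The boundary of a bare disc is one circle: corner moves and skipped edges run through the whole
rotation at `v`. -/
theorem mk_eq_mk_of_fst_eq [Finite V] {v : V} (hv : ∀ d : G.Dart, d.fst = v → d.toEdge ∉ A)
    {d d' : G.Dart} (hd : d.fst = v) (hd' : d'.fst = v) (s s' : Bool) :
    Quot.mk (S.BoundaryRel A) (d, s) = Quot.mk _ (d', s') := by
  obtain ⟨n, rfl⟩ := (S.rot_cyclic d d' (hd.trans hd'.symm)).exists_nat_pow_eq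
  have key : ∀ n, ((S.rot ^ n) d).fst = v ∧
      Quot.mk (S.BoundaryRel A) (d, s) = Quot.mk _ ((S.rot ^ n) d, true) := by
    intro n
    induction n with
    | zero => exact ⟨hd, mk_eq_of_notMem (hv d hd) _ _⟩
    | succ n ih =>
      have h1 : ((S.rot ^ (n + 1)) d).fst = v := by
        rw [pow_succ', Equiv.Perm.mul_apply, S.rot_fst, ih.1]
      refine ⟨h1, ih.2.trans ?_⟩
      rw [mk_eq_of_notMem (hv _ h1) true false, pow_succ', Equiv.Perm.mul_apply]
      exact (mk_corner (S := S) ((S.rot ^ n) d, true)).symm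
  exact (key n).2.trans (mk_eq_of_notMem (hv _ (key n).1) _ _)

theorem mk_join_eq_of_boundaryRel {f f' : G.Dart × Bool} (h : S.BoundaryRel A f f') :
    Quot.mk (JoinRel A) f.1.fst = Quot.mk _ f'.1.fst := by
  rcases h with rfl | rfl
  · rcases f with ⟨d, _ | _⟩
    · have := S.rot_fst (S.rot.symm d)
      rw [Equiv.apply_symm_apply] at this
      simp [cornerMove, this]
    · simp [cornerMove, S.rot_fst]
  · by_cases h : f.1.toEdge ∈ A
    · rw [edgeMove_of_mem h]
      exact Quot.sound ⟨f.1, h, rfl, rfl⟩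
    · rw [edgeMove_of_notMem h]

theorem boundaryCount_univ [Finite V] : S.boundaryCount Set.univ = S.faceCount := by
  unfold boundaryCount faceCount Face
  congr 1
  refine le_antisymm (Nat.card_quot_le_of_rel ?_) (Nat.card_quot_le_of_rel ?_)
  · rintro _ _ (⟨d, s⟩ | d)
    · exact Quot.sound (Or.inr (edgeMove_of_mem (f := (d, s)) (Set.mem_univ _)).symm)
    · exact Quot.sound (Or.inl rfl)
  · rintro ⟨d, s⟩ _ (rfl | rfl)
    · rcases s
      · have := Quot.sound (FaceRel.corner (S := S) (S.rot.symm d))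
        rw [Equiv.apply_symm_apply] at this
        exact this.symm
      · exact Quot.sound (FaceRel.corner d)
    · rw [edgeMove_of_mem (Set.mem_univ _)]
      exact Quot.sound (FaceRel.edge d s)

theorem ribbonGenus_univ [Finite V] : S.ribbonGenus Set.univ = S.eulerGenus := by
  rw [ribbonGenus, eulerGenus, boundaryCount_univ, componentCount_univ, Set.ncard_univ]
  ring

theorem card_eq_isolated_add [Finite V] (G : SimpleGraph V) : Nat.card V =
    Nat.card {v : V // ∃ w, G.Adj v w} + Nat.card {v : V // ∀ w, ¬ G.Adj v w} := by
  classical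
  rw [← Nat.card_sum]
  refine Nat.card_congr ((Equiv.sumCompl fun v => ∃ w, G.Adj v w).symm.trans
    (Equiv.sumCongr (Equiv.refl _) (Equiv.subtypeEquivRight fun v => ?_)))
  simp

theorem boundaryCount_empty_le [Finite V] : S.boundaryCount ∅ ≤ Nat.card V := by
  rw [boundaryCount, card_eq_isolated_add G]
  refine Nat.add_le_add_right (Nat.card_le_card_of_surjective
    (fun v : {v : V // ∃ w, G.Adj v w} => Quot.mk _ (⟨(v.1, _), v.2.choose_spec⟩, true)) ?_) _
  rintro ⟨d, s⟩
  refine ⟨⟨d.fst, d.snd, d.adj⟩, ?_⟩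
  apply mk_eq_mk_of_fst_eq (v := d.fst) (fun _ _ => id) <;> rfl

theorem ribbonGenus_empty_nonneg [Finite V] : 0 ≤ S.ribbonGenus ∅ := by
  have h1 := card_le_componentCount_empty (G := G)
  have h2 := S.boundaryCount_empty_le
  simp only [ribbonGenus, Set.ncard_empty]
  omega

/-- If the ends are already connected, the new edge pays for at most one new boundary component.
Otherwise at most one component is lost, and the ends lie on different boundary components, which
merge. -/
theorem ribbonGenus_le_insert [Finite V] (A : Set G.edgeSet) (e : G.edgeSet) :
    S.ribbonGenus A ≤ S.ribbonGenus (insert e A) := by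
  obtain ⟨d, rfl⟩ := Dart.toEdge_surjective e
  by_cases hd : d.toEdge ∈ A
  · rw [Set.insert_eq_of_mem hd]
  have h1 := Set.ncard_insert_of_notMem hd
  unfold ribbonGenus
  by_cases hj : Quot.mk (JoinRel A) d.fst = Quot.mk _ d.snd
  · have h2 := componentCount_le_insert_of_mk_eq hj
    have h3 := boundaryCount_insert_le (S := S) A d
    omega
  · have h2 := componentCount_le_insert A d
    have h3 := boundaryCount_insert_lt (S := S) hd fun h =>
      hj (congrArg (Quot.lift _ fun _ _ => mk_join_eq_of_boundaryRel) h)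
    omega

theorem ribbonGenus_insert_le [Finite V] (A : Set G.edgeSet) (e : G.edgeSet) :
    S.ribbonGenus (insert e A) + 2 * componentCount A ≤
      S.ribbonGenus A + 2 * componentCount (insert e A) + 2 := by
  obtain ⟨d, rfl⟩ := Dart.toEdge_surjective e
  by_cases hd : d.toEdge ∈ A
  · rw [Set.insert_eq_of_mem hd]
    omega
  have h1 := Set.ncard_insert_of_notMem hd
  have h2 := boundaryCount_le_insert (S := S) hd
  unfold ribbonGenus
  omega

theorem ribbonGenus_mono [Finite V] {A A' : Set G.edgeSet} (h : A ⊆ A') :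
    S.ribbonGenus A ≤ S.ribbonGenus A' := by
  have key : ∀ F : Set G.edgeSet, S.ribbonGenus A ≤ S.ribbonGenus (A ∪ F) := by
    intro F
    induction F, F.toFinite using Set.Finite.induction_on with
    | empty => rw [Set.union_empty]
    | insert _ _ ih => rw [Set.union_insert]; exact ih.trans (ribbonGenus_le_insert _ _)
  simpa [Set.union_eq_self_of_subset_left h] using key A'

theorem ribbonGenus_union_le [Finite V] (A F : Set G.edgeSet) :
    S.ribbonGenus (A ∪ F) + 2 * componentCount A ≤
      S.ribbonGenus A + 2 * componentCount (A ∪ F) + 2 * F.ncard := by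
  induction F, F.toFinite using Set.Finite.induction_on with
  | empty => simp
  | @insert e F he _ ih =>
    rw [Set.union_insert, Set.ncard_insert_of_notMem he]
    have := ribbonGenus_insert_le (S := S) (A ∪ F) e
    push_cast
    omega

theorem eulerGenus_nonneg [Finite V] : 0 ≤ S.eulerGenus := by
  rw [← ribbonGenus_univ]
  exact ribbonGenus_empty_nonneg.trans (ribbonGenus_mono (Set.subset_univ _))

/-- Edge sets on the two sides of a vertex partition have independent boundaries. -/
theorem boundaryCount_union_le [Finite V] {Z : Set V} {B W : Set G.edgeSet}
    (hB : ∀ d : G.Dart, d.toEdge ∈ B → d.fst ∉ Z) (hW : ∀ d : G.Dart, d.toEdge ∈ W → d.fst ∈ Z) :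
    S.boundaryCount (B ∪ W) + Nat.card V ≤ S.boundaryCount B + S.boundaryCount W := by
  classical
  let U := {v : V // ∃ w, G.Adj v w}
  let u : G.Dart → U := fun d => ⟨d.fst, d.snd, d.adj⟩
  let Q := Quot (S.BoundaryRel (B ∪ W))
  have hu : ∀ f : G.Dart × Bool, u (S.cornerMove f).1 = u f.1 := by
    rintro ⟨d, _ | _⟩
    · have := S.rot_fst (S.rot.symm d)
      rw [Equiv.apply_symm_apply] at this
      exact Subtype.ext this.symm
    · exact Subtype.ext (S.rot_fst d)
  -- Over `Y` the boundary is kept; each non-isolated vertex outside `Y` has a bare disc, whose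
  -- single boundary circle is recorded by the vertex.
  let val : Set V → G.Dart × Bool → Q ⊕ U := fun Y f =>
    if f.1.fst ∈ Y then Sum.inl (Quot.mk _ f) else Sum.inr (u f.1)
  have step : ∀ (C : Set G.edgeSet) (Y : Set V), (∀ d : G.Dart, d.toEdge ∈ C → d.fst ∈ Y) →
      (∀ d : G.Dart, d.fst ∈ Y → (d.toEdge ∈ C ↔ d.toEdge ∈ B ∪ W)) →
      ∀ f f', S.BoundaryRel C f f' → val Y f = val Y f' := by
    rintro C Y h1 h2 f f' (rfl | rfl)
    · simp only [val]
      have h3 : (S.cornerMove f).1.fst = f.1.fst := congrArg Subtype.val (hu f)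
      rw [h3, hu, mk_corner]
    · simp only [val]
      by_cases h : f.1.toEdge ∈ C
      · have h3 := h1 _ h
        rw [edgeMove_of_mem h, if_pos h3, if_pos (h1 f.1.symm (by simpa using h)), mk_symm]
        exact (h2 _ h3).1 h
      · rw [edgeMove_of_notMem h]
        by_cases h3 : f.1.fst ∈ Y
        · simp only [h3, if_true]
          rw [mk_not]
          rwa [← h2 _ h3]
        · simp only [h3, if_false]
  have hQ : Nat.card (Q ⊕ U) ≤
      Nat.card (Quot (S.BoundaryRel B) ⊕ Quot (S.BoundaryRel W)) := by
    refine Nat.card_le_card_of_surjective (Sum.elim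
      (Quot.lift (val Zᶜ) (step B Zᶜ hB fun d h => ?_))
      (Quot.lift (val Z) (step W Z hW fun d h => ?_))) ?_
    · exact ⟨Or.inl, fun h' => h'.resolve_right fun h'' => h (hW d h'')⟩
    · exact ⟨Or.inr, fun h' => h'.resolve_left fun h'' => hB d h'' h⟩
    · rintro (q | ⟨v, w, h⟩)
      · obtain ⟨f⟩ := q
        by_cases hf : f.1.fst ∈ Z
        · exact ⟨Sum.inr (Quot.mk _ f), if_pos hf⟩
        · exact ⟨Sum.inl (Quot.mk _ f), if_pos hf⟩
      · by_cases hf : v ∈ Z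
        · exact ⟨Sum.inl (Quot.mk _ (⟨(v, w), h⟩, true)), if_neg (not_not.2 hf)⟩
        · exact ⟨Sum.inr (Quot.mk _ (⟨(v, w), h⟩, true)), if_neg hf⟩
  rw [Nat.card_sum, Nat.card_sum] at hQ
  change Nat.card (Quot (S.BoundaryRel (B ∪ W))) + Nat.card {v : V // ∃ w, G.Adj v w} ≤ _ at hQ
  rw [card_eq_isolated_add G]
  unfold boundaryCount
  omega

theorem ribbonGenus_add_le [Finite V] {Z : Set V} {B W : Set G.edgeSet}
    (hB : ∀ d : G.Dart, d.toEdge ∈ B → d.fst ∉ Z) (hW : ∀ d : G.Dart, d.toEdge ∈ W → d.fst ∈ Z) :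
    S.ribbonGenus B + S.ribbonGenus W ≤ S.ribbonGenus (B ∪ W) := by
  have h1 := componentCount_add_le hB hW
  have h2 := boundaryCount_union_le (S := S) hB hW
  have h3 : (B ∪ W).ncard = B.ncard + W.ncard := by
    refine Set.ncard_union_eq (Set.disjoint_left.2 fun e he he' => ?_)
    obtain ⟨d, rfl⟩ := Dart.toEdge_surjective e
    exact hB d he (hW d he')
  unfold ribbonGenus
  omega

end EmbeddingScheme
end SimpleGraph

/-! ### First return maps of permutations -/

/-- The first return map of a permutation to the range of an injection is a permutation. -/
theorem Equiv.Perm.exists_firstReturn {α β : Type*} [Finite α] (σ : Equiv.Perm α) {ι : β → α}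
    (hι : Function.Injective ι) : ∃ τ : Equiv.Perm β, ∀ b, ∃ n : ℕ,
      ι (τ b) = (σ ^ (n + 1)) (ι b) ∧ ∀ m < n, (σ ^ (m + 1)) (ι b) ∉ Set.range ι := by
  classical
  have : Finite β := Finite.of_injective ι hι
  have hex : ∀ b, ∃ n : ℕ, (σ ^ (n + 1)) (ι b) ∈ Set.range ι := fun b => by
    obtain ⟨n, hn⟩ := Nat.exists_eq_add_one.2 (orderOf_pos σ)
    exact ⟨n, b, by rw [← hn, pow_orderOf_eq_one, Equiv.Perm.one_apply]⟩
  choose f hf using fun b => Nat.find_spec (hex b)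
  -- Cancelling the shorter return time puts `ι a` on the orbit of `ι b` strictly before its first
  -- return, unless the times agree.
  have hlt : ∀ a b, f a = f b → Nat.find (hex a) ≤ Nat.find (hex b) → a = b := by
    intro a b hab hle
    obtain ⟨k, hk⟩ := Nat.exists_eq_add_of_le hle
    have h1 : (σ ^ (Nat.find (hex a) + 1)) (ι a) =
        (σ ^ (Nat.find (hex a) + 1)) ((σ ^ k) (ι b)) := by
      rw [← Equiv.Perm.mul_apply, ← pow_add, ← hf a, hab, hf b]
      congr 2
      omega
    replace h1 := (σ ^ (Nat.find (hex a) + 1)).injective h1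
    rcases k with _ | k
    · exact hι h1
    · exact absurd ⟨a, h1⟩ (Nat.find_min (hex b) (m := k) (by omega))
  have hinj : Function.Injective f := fun a b hab =>
    (le_total _ _).elim (hlt a b hab) fun h => (hlt b a hab.symm h).symm
  exact ⟨Equiv.ofBijective f (Finite.injective_iff_bijective.1 hinj), fun b =>
    ⟨Nat.find (hex b), hf b, fun m => Nat.find_min (hex b)⟩⟩

/-- A positive number of `σ`-steps from `ι a` to `ι b` cannot end before the first return, so one
step of `τ` shortens it. -/
theorem Equiv.Perm.SameCycle.of_firstReturn {α β : Type*} [Finite α] {σ : Equiv.Perm α}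
    {ι : β → α} (hι : Function.Injective ι) {τ : Equiv.Perm β} (hτ : ∀ b, ∃ n : ℕ,
      ι (τ b) = (σ ^ (n + 1)) (ι b) ∧ ∀ m < n, (σ ^ (m + 1)) (ι b) ∉ Set.range ι)
    {a b : β} (h : σ.SameCycle (ι a) (ι b)) : τ.SameCycle a b := by
  obtain ⟨N, hN⟩ := h.exists_nat_pow_eq
  induction N using Nat.strong_induction_on generalizing a with
  | _ N ih =>
    rcases N with _ | N
    · rw [hι hN]
    · obtain ⟨n, hn, hmin⟩ := hτ a
      have hle : n ≤ N := by
        by_contra! hlt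
        exact hmin N hlt ⟨b, hN.symm⟩
      obtain ⟨k, rfl⟩ := Nat.exists_eq_add_of_le hle
      have hk : (σ ^ k) (ι (τ a)) = ι b := by
        rw [hn, ← Equiv.Perm.mul_apply, ← pow_add, ← hN]
        congr 2
        omega
      exact Equiv.Perm.sameCycle_apply_left.1 (ih k (by omega) ⟨k, by simpa using hk⟩ hk)

/-! ### The embedding scheme induced after deleting vertices -/

namespace SimpleGraph

variable {V : Type*} {G : SimpleGraph V} {Z : Set V}

/-- The inclusion of the darts of an induced subgraph. -/
def inducedDart (Z : Set V) : (G.induce Zᶜ).Dart → G.Dart := (Embedding.induce Zᶜ).toHom.mapDart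

theorem inducedDart_injective : Function.Injective (inducedDart (G := G) Z) := by
  intro d d' h
  have h1 := congrArg Dart.toProd h
  apply Dart.ext
  exact Prod.ext (Subtype.ext (congrArg Prod.fst h1)) (Subtype.ext (congrArg Prod.snd h1))

/-- The edges with no end in `Z`. -/
def edgesAvoiding (G : SimpleGraph V) (Z : Set V) : Set G.edgeSet := {e | ∀ v ∈ e.1, v ∉ Z}

theorem toEdge_mem_edgesAvoiding {d : G.Dart} :
    d.toEdge ∈ G.edgesAvoiding Z ↔ d.fst ∉ Z ∧ d.snd ∉ Z := by
  change (∀ v ∈ s(d.fst, d.snd), v ∉ Z) ↔ _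
  simp

theorem mem_range_inducedDart {d : G.Dart} :
    d ∈ Set.range (inducedDart Z) ↔ d.toEdge ∈ G.edgesAvoiding Z := by
  rw [toEdge_mem_edgesAvoiding]
  constructor
  · rintro ⟨d, rfl⟩
    exact ⟨d.fst.2, d.snd.2⟩
  · rintro ⟨h1, h2⟩
    exact ⟨⟨(⟨d.fst, h1⟩, ⟨d.snd, h2⟩), d.adj⟩, rfl⟩

theorem card_connectedComponent_induce_le [Finite V] (G : SimpleGraph V) (Z : Set V) :
    Nat.card (G.induce Zᶜ).ConnectedComponent + Z.ncard ≤
      componentCount (G.edgesAvoiding Z) := by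
  classical
  rw [← Nat.card_coe_set_eq, ← Nat.card_sum]
  refine Nat.card_le_card_of_surjective (Quot.lift (fun v => if h : v ∈ Z then Sum.inr ⟨v, h⟩
    else Sum.inl ((G.induce Zᶜ).connectedComponentMk ⟨v, h⟩)) ?_) ?_
  · rintro v w ⟨d, hd, rfl, rfl⟩
    obtain ⟨h1, h2⟩ := toEdge_mem_edgesAvoiding.1 hd
    simp only [h1, h2, dite_false]
    refine congrArg _ (ConnectedComponent.sound (Adj.reachable ?_))
    exact d.adj
  · rintro (q | ⟨v, hv⟩)
    · obtain ⟨v, hv⟩ := q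
      exact ⟨Quot.mk _ v, dif_neg hv⟩
    · exact ⟨Quot.mk _ v, dif_pos hv⟩

theorem card_edgeSet_induce_le [Finite V] (G : SimpleGraph V) (Z : Set V) :
    Nat.card (G.induce Zᶜ).edgeSet ≤ (G.edgesAvoiding Z).ncard := by
  rw [← Nat.card_coe_set_eq]
  refine Nat.card_le_card_of_injective (fun e => ⟨(Embedding.induce Zᶜ).mapEdgeSet e, ?_⟩)
    fun e e' h => (Embedding.induce Zᶜ).mapEdgeSet.injective (congrArg Subtype.val h)
  obtain ⟨d, rfl⟩ := Dart.toEdge_surjective e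
  exact mem_range_inducedDart.1 ⟨d, rfl⟩

namespace EmbeddingScheme

variable (S : EmbeddingScheme G)

theorem exists_induce [Finite V] (Z : Set V) : ∃ S' : EmbeddingScheme (G.induce Zᶜ),
    (∀ d, ∃ n : ℕ, inducedDart Z (S'.rot d) = (S.rot ^ (n + 1)) (inducedDart Z d) ∧
      ∀ m < n, (S.rot ^ (m + 1)) (inducedDart Z d) ∉ Set.range (inducedDart (G := G) Z)) ∧
    ∀ d : (G.induce Zᶜ).Dart, S'.twist d.toEdge = S.twist (inducedDart Z d).toEdge := by
  obtain ⟨τ, hτ⟩ := S.rot.exists_firstReturn (inducedDart_injective (G := G) (Z := Z))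
  have hfst : ∀ (n : ℕ) (d : G.Dart), ((S.rot ^ n) d).fst = d.fst := by
    intro n d
    induction n with
    | zero => rfl
    | succ n ih => rw [pow_succ', Equiv.Perm.mul_apply, S.rot_fst, ih]
  refine ⟨⟨τ, fun d => ?_, fun d d' h => ?_,
    fun e => S.twist ((Embedding.induce Zᶜ).mapEdgeSet e)⟩, hτ, fun d => rfl⟩
  · obtain ⟨n, hn, -⟩ := hτ d
    have h := congrArg (fun d : G.Dart => d.fst) hn
    simp only [hfst] at h
    exact Subtype.ext h
  · exact Equiv.Perm.SameCycle.of_firstReturn inducedDart_injective hτ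
      (S.rot_cyclic _ _ (congrArg Subtype.val h))

variable {S}

theorem exists_mk_eq_mk_inducedDart (n : ℕ) {d : G.Dart}
    (h : (S.rot ^ n) d ∈ Set.range (inducedDart Z)) (s : Bool) :
    ∃ (d' : (G.induce Zᶜ).Dart) (s' : Bool),
      Quot.mk (S.BoundaryRel (G.edgesAvoiding Z)) (inducedDart Z d', s') = Quot.mk _ (d, s) := by
  induction n generalizing d s with
  | zero =>
    obtain ⟨d', rfl⟩ := h
    exact ⟨d', s, rfl⟩
  | succ n ih =>
    by_cases hd : d ∈ Set.range (inducedDart Z)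
    · obtain ⟨d', rfl⟩ := hd
      exact ⟨d', s, rfl⟩
    · rw [pow_succ, Equiv.Perm.mul_apply] at h
      obtain ⟨d', s', h'⟩ := ih h false
      rw [mem_range_inducedDart] at hd
      exact ⟨d', s', h'.trans ((mk_corner (d, true)).trans (mk_eq_of_notMem hd _ _))⟩

/-- A boundary class not met by a surviving dart is the circle of a bare vertex. Such a vertex lies
in `Z` or is isolated in the induced subgraph, where it has a face of its own. -/
theorem boundaryCount_edgesAvoiding_le [Finite V] {S' : EmbeddingScheme (G.induce Zᶜ)}
    (hrot : ∀ d, ∃ n : ℕ, inducedDart Z (S'.rot d) = (S.rot ^ (n + 1)) (inducedDart Z d) ∧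
      ∀ m < n, (S.rot ^ (m + 1)) (inducedDart Z d) ∉ Set.range (inducedDart (G := G) Z))
    (htwist : ∀ d : (G.induce Zᶜ).Dart, S'.twist d.toEdge = S.twist (inducedDart Z d).toEdge) :
    S.boundaryCount (G.edgesAvoiding Z) ≤ S'.faceCount + Z.ncard := by
  classical
  let Q := Quot (S.BoundaryRel (G.edgesAvoiding Z)) ⊕ {v : V // ∀ w, ¬ G.Adj v w}
  let vertexClass : V → Q := fun v =>
    if h : ∃ w, G.Adj v w then Sum.inl (Quot.mk _ (⟨(v, h.choose), h.choose_spec⟩, true))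
    else Sum.inr ⟨v, not_exists.1 h⟩
  let faceClass : S'.Face → Q :=
    Quot.lift (fun f => Sum.inl (Quot.mk _ (inducedDart Z f.1, f.2))) (by
      rintro _ _ (⟨d, s⟩ | d)
      · have h := mk_symm (S := S) (mem_range_inducedDart.1 ⟨d, rfl⟩) s
        rw [← htwist] at h
        exact congrArg Sum.inl h.symm
      · obtain ⟨n, hn, hmin⟩ := hrot d
        have key : ∀ m ≤ n, Quot.mk (S.BoundaryRel (G.edgesAvoiding Z)) (inducedDart Z d, true) =
            Quot.mk _ ((S.rot ^ (m + 1)) (inducedDart Z d), false) := by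
          intro m hm
          induction m with
          | zero => exact (mk_corner (inducedDart Z d, true)).symm
          | succ m ih =>
            have h := hmin m (by omega)
            rw [mem_range_inducedDart] at h
            rw [ih (by omega), mk_eq_of_notMem h false true, pow_succ' S.rot (m + 1),
              Equiv.Perm.mul_apply]
            exact (mk_corner ((S.rot ^ (m + 1)) (inducedDart Z d), true)).symm
        have h := key n le_rfl
        rw [← hn] at h
        exact congrArg Sum.inl h)
  have hsurj : Function.Surjective (Sum.elim (Sum.elim faceClass
      fun v : {v : (Zᶜ : Set V) // ∀ w, ¬ (G.induce Zᶜ).Adj v w} => vertexClass v.1.1)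
      fun v : Z => vertexClass v.1) := by
    have hv : ∀ v, (∀ d : G.Dart, d.fst = v → d.toEdge ∉ G.edgesAvoiding Z) →
        ∃ x, (Sum.elim (Sum.elim faceClass
          fun v : {v : (Zᶜ : Set V) // ∀ w, ¬ (G.induce Zᶜ).Adj v w} => vertexClass v.1.1)
          fun v : Z => vertexClass v.1) x = vertexClass v := by
      intro v hv
      by_cases hZ : v ∈ Z
      · exact ⟨Sum.inr ⟨v, hZ⟩, rfl⟩
      · refine ⟨Sum.inl (Sum.inr ⟨⟨v, hZ⟩, fun w hw => ?_⟩), rfl⟩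
        exact hv ⟨(v, w.1), hw⟩ rfl (toEdge_mem_edgesAvoiding.2 ⟨hZ, w.2⟩)
    rintro (q | v)
    · obtain ⟨d, s⟩ := q
      by_cases h : ∃ d' : G.Dart, d'.fst = d.fst ∧ d'.toEdge ∈ G.edgesAvoiding Z
      · obtain ⟨d', h1, h2⟩ := h
        obtain ⟨n, hn⟩ := (S.rot_cyclic d d' h1.symm).exists_nat_pow_eq
        rw [← mem_range_inducedDart, ← hn] at h2
        obtain ⟨d'', s', h3⟩ := exists_mk_eq_mk_inducedDart n h2 s
        exact ⟨Sum.inl (Sum.inl (Quot.mk _ (d'', s'))), congrArg Sum.inl h3⟩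
      · push Not at h
        obtain ⟨x, hx⟩ := hv d.fst h
        refine ⟨x, hx.trans ((dif_pos ⟨d.snd, d.adj⟩).trans (congrArg Sum.inl ?_))⟩
        apply mk_eq_mk_of_fst_eq h <;> rfl
    · obtain ⟨x, hx⟩ := hv v.1 fun d hd => absurd (hd ▸ d.adj) (v.2 _)
      exact ⟨x, hx.trans (dif_neg (not_exists.2 v.2))⟩
  have : Finite S'.Face := inferInstanceAs (Finite (Quot S'.FaceRel))
  have h := Nat.card_le_card_of_surjective _ hsurj
  rwa [Nat.card_sum, Nat.card_sum, Nat.card_sum, Nat.card_coe_set_eq] at h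

/-- A vertex of `Z` kept as a bare disc contributes `2 - 1 - 1 = 0` to the ribbon genus. -/
theorem exists_eulerGenus_induce_le [Finite V] (S : EmbeddingScheme G) (Z : Set V) :
    ∃ S' : EmbeddingScheme (G.induce Zᶜ),
      S'.eulerGenus ≤ S.ribbonGenus (G.edgesAvoiding Z) := by
  obtain ⟨S', hrot, htwist⟩ := S.exists_induce Z
  refine ⟨S', ?_⟩
  have h1 := boundaryCount_edgesAvoiding_le hrot htwist
  have h2 := card_connectedComponent_induce_le G Z
  have h3 := card_edgeSet_induce_le G Z
  have h4 := Set.ncard_add_ncard_compl Z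
  rw [← Nat.card_coe_set_eq Zᶜ] at h4
  unfold eulerGenus ribbonGenus
  omega

end EmbeddingScheme
end SimpleGraph

/-! ### BFS trees and the edges that carry the genus -/

namespace SimpleGraph

variable {V : Type*} {G : SimpleGraph V} {r : V} {p : V → V}

/-- `p` sends each vertex other than `r` to a neighbour that is closer to `r`. -/
def IsBFSParent (G : SimpleGraph V) (r : V) (p : V → V) : Prop :=
  ∀ v, v ≠ r → G.Adj v (p v) ∧ G.dist r v = G.dist r (p v) + 1

theorem Connected.exists_isBFSParent (hG : G.Connected) (r : V) : ∃ p, G.IsBFSParent r p := by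
  have key : ∀ v, ∃ w, v ≠ r → G.Adj v w ∧ G.dist r v = G.dist r w + 1 := by
    intro v
    by_cases hv : v = r
    · exact ⟨v, fun h => absurd hv h⟩
    obtain ⟨q, hq⟩ := hG.exists_walk_length_eq_dist v r
    cases q with
    | nil => exact absurd rfl hv
    | @cons _ w _ h q =>
      refine ⟨w, fun _ => ⟨h, ?_⟩⟩
      have h1 := dist_le q
      have h2 := hG.dist_triangle (u := v) (v := w) (w := r)
      rw [dist_eq_one_iff_adj.2 h] at h2
      rw [Walk.length_cons] at hq
      rw [dist_comm, G.dist_comm (u := r)]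
      omega
  choose p hp using key
  exact ⟨p, hp⟩

/-- The edges from a vertex to its parent. -/
def parentEdges (G : SimpleGraph V) (r : V) (p : V → V) : Set G.edgeSet :=
  {e | ∃ v, v ≠ r ∧ e.1 = s(v, p v)}

namespace IsBFSParent

variable (hp : G.IsBFSParent r p) {A : Set G.edgeSet}
include hp

theorem dist_iterate (v : V) {k : ℕ} (hk : k ≤ G.dist r v) :
    G.dist r (p^[k] v) + k = G.dist r v := by
  induction k with
  | zero => rfl
  | succ k ih =>
    have h1 := ih (by omega)
    have h2 : p^[k] v ≠ r := by
      intro h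
      rw [h, dist_self] at h1
      omega
    rw [Function.iterate_succ_apply']
    have := (hp _ h2).2
    omega

theorem mk_eq_mk_root (hA : G.parentEdges r p ⊆ A) (v : V) :
    Quot.mk (JoinRel A) v = Quot.mk _ r := by
  induction hn : G.dist r v generalizing v with
  | zero =>
    by_cases hv : v = r
    · rw [hv]
    · have := (hp v hv).2
      omega
  | succ n ih =>
    by_cases hv : v = r
    · rw [hv]
    · obtain ⟨h1, h2⟩ := hp v hv
      rw [← ih (p v) (by omega)]
      exact Quot.sound ⟨⟨(v, p v), h1⟩, hA ⟨v, hv, rfl⟩, rfl, rfl⟩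

theorem componentCount_eq_one [Finite V] (hA : G.parentEdges r p ⊆ A) : componentCount A = 1 := by
  refine Nat.card_eq_one_iff_exists.2 ⟨Quot.mk _ r, ?_⟩
  rintro ⟨v⟩
  exact hp.mk_eq_mk_root hA v

theorem ncard_parentEdges_add_one [Finite V] : (G.parentEdges r p).ncard + 1 = Nat.card V := by
  classical
  let f : {v // v ≠ r} → G.edgeSet := fun v => ⟨s(v.1, p v.1), (hp v.1 v.2).1⟩
  have hf : Function.Injective f := by
    intro v w h
    have h1 := (hp v.1 v.2).2
    have h2 := (hp w.1 w.2).2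
    rcases Sym2.eq_iff.1 (congrArg Subtype.val h) with h | ⟨h3, h4⟩
    · exact Subtype.ext h.1
    · rw [h3] at h1
      rw [h3] at h4
      rw [h4] at h1
      omega
  have h : G.parentEdges r p = Set.range f := by
    ext e
    constructor
    · rintro ⟨v, hv, he⟩
      exact ⟨⟨v, hv⟩, Subtype.ext he.symm⟩
    · rintro ⟨v, rfl⟩
      exact ⟨v.1, v.2, rfl⟩
  rw [h, ← Nat.card_coe_set_eq, Nat.card_range_of_injective hf, ← Finite.card_option]
  exact Nat.card_congr (Equiv.optionSubtypeNe r)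

/-- A spanning unicellular ribbon subgraph of full genus, by removing a spanning tree of the
dual graph. -/
theorem exists_ribbonGenus_univ_le [Finite V] (S : EmbeddingScheme G) :
    ∃ A, G.parentEdges r p ⊆ A ∧ S.ribbonGenus Set.univ ≤ S.ribbonGenus A ∧
      ((A \ G.parentEdges r p).ncard : ℤ) ≤ S.ribbonGenus Set.univ := by
  obtain ⟨A, ⟨hTA, hA⟩, hmin⟩ := exists_minimal_of_wellFoundedLT
    (fun A => G.parentEdges r p ⊆ A ∧ S.ribbonGenus Set.univ ≤ S.ribbonGenus A)
    ⟨Set.univ, Set.subset_univ _, le_rfl⟩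
  refine ⟨A, hTA, hA, ?_⟩
  -- If the sides were on different boundary components, deleting the edge would lower `|A|` by one
  -- and the boundary count by at least one. The genus would not drop, against minimality.
  have hside : ∀ d : G.Dart, d.toEdge ∈ A → d.toEdge ∉ G.parentEdges r p →
      Quot.mk (S.BoundaryRel A) (d, true) = Quot.mk _ (d, false) := by
    intro d hdA hdT
    by_contra hne
    have hins : insert d.toEdge (A \ {d.toEdge}) = A := by
      rw [Set.insert_sdiff_singleton, Set.insert_eq_of_mem hdA]
    have hsub : G.parentEdges r p ⊆ A \ {d.toEdge} := Set.subset_sdiff_singleton hTA hdT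
    rw [← hins] at hne
    have h1 := EmbeddingScheme.boundaryCount_lt_insert (by simp) hne
    rw [hins] at h1
    have h2 := Set.ncard_sdiff_singleton_add_one hdA
    have h3 := hp.componentCount_eq_one hsub
    have h4 := hp.componentCount_eq_one hTA
    refine (hmin ⟨hsub, hA.trans ?_⟩ Set.sdiff_subset hdA).2 rfl
    unfold EmbeddingScheme.ribbonGenus
    omega
  have h1 : S.boundaryCount A ≤ S.boundaryCount (G.parentEdges r p) := by
    refine Nat.add_le_add_right (Nat.card_quot_le_of_rel ?_) _
    rintro f _ (rfl | rfl)
    · exact (EmbeddingScheme.mk_corner f).symm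
    · by_cases h : f.1.toEdge ∈ A ∧ f.1.toEdge ∉ G.parentEdges r p
      · rw [EmbeddingScheme.edgeMove_of_notMem h.2]
        have := hside f.1 h.1 h.2
        rcases f with ⟨d, _ | _⟩
        exacts [this.symm, this]
      · rw [← EmbeddingScheme.mk_edgeMove f]
        congr 1
        apply EmbeddingScheme.edgeMove_congr
        have := @hTA f.1.toEdge
        tauto
  have h2 := hp.ncard_parentEdges_add_one
  have h3 := hp.componentCount_eq_one hTA
  have h4 := hp.componentCount_eq_one subset_rfl
  have h5 := S.ribbonGenus_empty_nonneg.trans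
    (EmbeddingScheme.ribbonGenus_mono (Set.empty_subset (G.parentEdges r p)))
  -- With one component and `|V| - 1` edges, `h5` says that the tree has at most one boundary
  -- component.
  have h6 := EmbeddingScheme.ribbonGenus_mono (S := S) (Set.subset_univ A)
  have h7 := Set.ncard_sdiff_add_ncard_of_subset hTA
  rw [EmbeddingScheme.ribbonGenus] at h5
  rw [EmbeddingScheme.ribbonGenus] at h6
  omega

/-- The genus of a ribbon subgraph is carried by a set of vertices that contains the ends of all
edges outside the tree and is closed under taking parents. -/
theorem ribbonGenus_le_of_closed [Finite V] {S : EmbeddingScheme G}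
    (hTA : G.parentEdges r p ⊆ A) {Z : Set V} (hZ : ∀ v ∈ Z, v ≠ r → p v ∈ Z)
    (hAZ : ∀ e ∈ A, e ∉ G.parentEdges r p → ∀ v ∈ e.1, v ∈ Z) :
    S.ribbonGenus A ≤ S.ribbonGenus {e ∈ A | ∀ v ∈ e.1, v ∈ Z} := by
  classical
  set W := {e ∈ A | ∀ v ∈ e.1, v ∈ Z} with hW
  have hWA : W ⊆ A := Set.sep_subset _ _
  have h1 := EmbeddingScheme.ribbonGenus_union_le (S := S) W (A \ W)
  rw [Set.union_sdiff_cancel hWA, hp.componentCount_eq_one hTA] at h1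
  -- A dropped edge joins some `v ≠ r` to its parent, and `v ∉ Z` because `Z` is closed under
  -- parents.
  have h2 : (A \ W).ncard ≤ (insert r Z)ᶜ.ncard := by
    have key : ∀ e : ↥(A \ W), ∃ v : ↥(insert r Z)ᶜ, e.1.1 = s(v.1, p v.1) := by
      rintro ⟨e, heA, heW⟩
      obtain ⟨v, hv, he⟩ : e ∈ G.parentEdges r p := by
        by_contra h
        exact heW ⟨heA, hAZ e heA h⟩
      refine ⟨⟨v, fun h => heW ⟨heA, ?_⟩⟩, he⟩
      have hvZ : v ∈ Z := h.resolve_left hv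
      rw [he]
      simpa [hvZ] using hZ v hvZ hv
    choose f hf using key
    rw [← Nat.card_coe_set_eq, ← Nat.card_coe_set_eq]
    refine Nat.card_le_card_of_injective f fun e e' h => ?_
    exact Subtype.ext (Subtype.ext ((hf e).trans (h ▸ (hf e').symm)))
  -- Vertices outside `insert r Z` are isolated in `W`, and `r` gives one more component. So each
  -- dropped edge costs a component, which cancels its possible genus gain of `2` in `h1`.
  have h3 : (insert r Z)ᶜ.ncard + 1 ≤ componentCount W := by
    rw [← Nat.card_coe_set_eq, ← Finite.card_option]
    refine Nat.card_le_card_of_surjective (Quot.lift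
      (fun v => if h : v ∈ (insert r Z)ᶜ then some ⟨v, h⟩ else none) ?_) ?_
    · rintro v w ⟨d, ⟨-, hd⟩, rfl, rfl⟩
      have h1 : d.fst ∈ Z := hd _ (Sym2.mem_mk_left _ _)
      have h2 : d.snd ∈ Z := hd _ (Sym2.mem_mk_right _ _)
      simp [h1, h2]
    · rintro (_ | ⟨v, hv⟩)
      · exact ⟨Quot.mk _ r, dif_neg (by simp)⟩
      · exact ⟨Quot.mk _ v, dif_pos hv⟩
  omega

/-- Each parent step lowers the distance by one, so the ancestor of `u` in layer `i` can only be the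
iterate of order `G.dist r u - i`. -/
theorem ncard_ancestors_inter_le [Finite V] (U : Set V) (i : ℕ) :
    ({v | ∃ u ∈ U, ∃ k ≤ G.dist r u, p^[k] u = v} ∩ {v | G.dist r v = i}).ncard ≤ U.ncard := by
  refine (Set.ncard_le_ncard ?_).trans
    (Set.ncard_image_le (f := fun u => p^[G.dist r u - i] u) U.toFinite)
  rintro v ⟨⟨u, hu, k, hk, rfl⟩, hi⟩
  refine ⟨u, hu, ?_⟩
  have h := hp.dist_iterate u hk
  simp only [Set.mem_ofPred_eq] at hi
  simp only
  congr 1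
  rw [← h, hi, Nat.add_sub_cancel_left]

end IsBFSParent

theorem ncard_ends_le [Finite V] (X : Set G.edgeSet) :
    {v | ∃ e ∈ X, v ∈ e.1}.ncard ≤ 2 * X.ncard := by
  choose f hf using Dart.toEdge_surjective (G := G)
  have h : {v | ∃ e ∈ X, v ∈ e.1} ⊆
      (fun e => (f e).fst) '' X ∪ (fun e => (f e).snd) '' X := by
    rintro v ⟨e, he, hv⟩
    rw [← hf e] at hv
    rcases Sym2.mem_iff.1 (show v ∈ s((f e).fst, (f e).snd) from hv) with rfl | rfl
    exacts [Or.inl ⟨e, he, rfl⟩, Or.inr ⟨e, he, rfl⟩]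
  have h1 := Set.ncard_le_ncard h
  have h2 := Set.ncard_union_le ((fun e => (f e).fst) '' X) ((fun e => (f e).snd) '' X)
  have h3 := Set.ncard_image_le (f := fun e => (f e).fst) X.toFinite
  have h4 := Set.ncard_image_le (f := fun e => (f e).snd) X.toFinite
  omega

end SimpleGraph

/-! ### The main theorem -/

open SimpleGraph in
theorem mainTheorem5 {V : Type*} [Finite V] (G : SimpleGraph V) (hG : G.Connected)
    (g : ℕ) (hg : G.HasEulerGenus g) (t : ℕ) (L : Fin (t + 1) → Set V)
    (hL : G.IsBFSLayering L) :
    ∃ Z : Set V, (∀ i, (Z ∩ L i).ncard ≤ 2 * g) ∧ (G.induce Zᶜ).IsPlanar := by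
  obtain ⟨⟨S, hS⟩, -⟩ := hg
  obtain ⟨r, -, hL⟩ := hL
  obtain ⟨p, hp⟩ := hG.exists_isBFSParent r
  obtain ⟨A, hTA, hA, hX⟩ := hp.exists_ribbonGenus_univ_le S
  let U : Set V := {v | ∃ e ∈ A \ G.parentEdges r p, v ∈ e.1}
  -- The bound on `k` stops at the root, where `p` is arbitrary.
  let Z : Set V := {v | ∃ u ∈ U, ∃ k ≤ G.dist r u, p^[k] u = v}
  have hclosed : ∀ v ∈ Z, v ≠ r → p v ∈ Z := by
    rintro _ ⟨u, hu, k, hk, rfl⟩ hne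
    refine ⟨u, hu, k + 1, ?_, Function.iterate_succ_apply' p k u⟩
    have h1 := hp.dist_iterate u hk
    have h2 := (hp _ hne).2
    omega
  have hends : ∀ e ∈ A, e ∉ G.parentEdges r p → ∀ v ∈ e.1, v ∈ Z := fun e he heT v hv =>
    ⟨v, ⟨e, ⟨he, heT⟩, hv⟩, 0, Nat.zero_le _, rfl⟩
  refine ⟨Z, fun i => ?_, ?_⟩
  · have h1 := hp.ncard_ancestors_inter_le U i
    have h2 : U.ncard ≤ _ := ncard_ends_le (A \ G.parentEdges r p)
    rw [EmbeddingScheme.ribbonGenus_univ, hS] at hX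
    rw [hL]
    exact h1.trans (h2.trans (by omega))
  · obtain ⟨S', hS'⟩ := S.exists_eulerGenus_induce_le Z
    refine ⟨S', le_antisymm ?_ S'.eulerGenus_nonneg⟩
    -- The edges of `A` inside `Z` use up the whole genus, so by superadditivity the edges avoiding
    -- `Z` have genus at most `0`.
    have h1 := hp.ribbonGenus_le_of_closed (S := S) hTA hclosed hends
    have h2 := EmbeddingScheme.ribbonGenus_add_le (S := S) (Z := Z) (B := G.edgesAvoiding Z)
      (fun d hd => (toEdge_mem_edgesAvoiding.1 hd).1)
      (W := {e ∈ A | ∀ v ∈ e.1, v ∈ Z}) (fun d hd => hd.2 _ (Sym2.mem_mk_left _ _))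
    have h3 := EmbeddingScheme.ribbonGenus_mono (S := S)
      (Set.subset_univ (G.edgesAvoiding Z ∪ {e ∈ A | ∀ v ∈ e.1, v ∈ Z}))
    omega
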